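/- Let $K$ be an algebraically closed field, let $n \ge 0$ and $m \ge 1$ be integers, and let $\mathrm{Mat}_{n,n}^m$ be the space of $m$-tuples of $n \times n$ matrices over $K$. The group $\mathrm{GL}_n = \mathrm{GL}_n(K)$ acts on $\mathrm{Mat}_{n,n}^{m}$ by simultaneous conjugation, $g \cdot (X_1,\dots,X_{m}) = (gX_1g^{-1},\dots,gX_{m}g^{-1})$, and likewise on $\mathrm{Mat}_{n,n}^{m-1}$; the group $\mathrm{SL}_n \times \mathrm{SL}_n$ (over $K$) acts on $\mathrm{Mat}_{n,n}^m$ by the left-right action $(P,Q) \cdot (X_1,\dots,X_m) = (PX_1Q^{-1},\dots,PX_mQ^{-1})$. Write $X \sim_C Y$ if the Zariski closures of the orbits of $X$ and $Y$ under simultaneous conjugation intersect, and $X \sim_{LR} Y$ if the Zariski closures of their orbits under the left-right action intersect. Let $A = (A_1,\dots,A_m)$ and $B = (B_1,\dots,B_m)$ be elements of $\mathrm{Mat}_{n,n}^m$ with $\det(A_1) = \det(B_1) \neq 0$. Put $\widetilde{A} = (A_1^{-1}A_2,\dots,A_1^{-1}A_m)$ and $\widetilde{B} = (B_1^{-1}B_2,\dots,B_1^{-1}B_m)$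 in $\mathrm{Mat}_{n,n}^{m-1}$. Then $$A \sim_{LR} B \iff \widetilde{A} \sim_C \widetilde{B}.$$ -/

import Mathlib

open scoped Matrix MatrixGroups

/-- The space of `m`-tuples of `n × n` matrices with entries in `K`. -/
abbrev MatTuple (K : Type*) (n m : ℕ) : Type _ :=
  Fin m → Matrix (Fin n) (Fin n) K

/-- The matrix entries of a tuple, as a point of the affine space `K ^ (m * n * n)`. -/
def MatTuple.coords {K : Type*} {n m : ℕ} (X : MatTuple K n m) :
    Fin m × Fin n × Fin n → K :=
  fun p => X p.1 p.2.1 p.2.2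

/-- The Zariski closure of a set of matrix tuples: the common zeros of all polynomials in the
matrix entries that vanish on the set. -/
def zariskiClosure {K : Type*} [Field K] {n m : ℕ} (S : Set (MatTuple K n m)) :
    Set (MatTuple K n m) :=
  MatTuple.coords ⁻¹'
    MvPolynomial.zeroLocus K (MvPolynomial.vanishingIdeal K (MatTuple.coords '' S))

/-- Two points are closure equivalent for an action `a` of a group `G` on the space of matrix
tuples if the Zariski closures of their orbits intersect. -/
def ClosureEquiv {K : Type*} [Field K] {n m : ℕ} {G : Type*} [Group G]
    (a : MulAction G (MatTuple K n m)) (X Y : MatTuple K n m) : Prop :=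
  (zariskiClosure (@MulAction.orbit G (MatTuple K n m) a.toSMul X) ∩
    zariskiClosure (@MulAction.orbit G (MatTuple K n m) a.toSMul Y)).Nonempty

/-- Simultaneous conjugation: `g • (X₁, …, Xₘ) = (g X₁ g⁻¹, …, g Xₘ g⁻¹)` for `g ∈ GLₙ`. -/
@[reducible] def conjAction (K : Type*) [Field K] (n m : ℕ) :
    MulAction (GL (Fin n) K) (MatTuple K n m) where
  smul g X := fun i =>
    (g : Matrix (Fin n) (Fin n) K) * X i * ((g⁻¹ : GL (Fin n) K) : Matrix (Fin n) (Fin n) K)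
  one_smul X := by
    funext i
    change ((1 : GL (Fin n) K) : Matrix (Fin n) (Fin n) K) * X i *
      ((1⁻¹ : GL (Fin n) K) : Matrix (Fin n) (Fin n) K) = X i
    rw [inv_one, Units.val_one, one_mul, mul_one]
  mul_smul g h X := by
    funext i
    change ((g * h : GL (Fin n) K) : Matrix (Fin n) (Fin n) K) * X i *
        (((g * h)⁻¹ : GL (Fin n) K) : Matrix (Fin n) (Fin n) K) =
      (g : Matrix (Fin n) (Fin n) K) *
        ((h : Matrix (Fin n) (Fin n) K) * X i *
          ((h⁻¹ : GL (Fin n) K) : Matrix (Fin n) (Fin n) K)) *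
        ((g⁻¹ : GL (Fin n) K) : Matrix (Fin n) (Fin n) K)
    rw [mul_inv_rev, Units.val_mul, Units.val_mul]
    simp only [mul_assoc]

/-- The left-right action: `(P, Q) • (X₁, …, Xₘ) = (P X₁ Q⁻¹, …, P Xₘ Q⁻¹)` for
`(P, Q) ∈ SLₙ × SLₙ`. -/
@[reducible] def leftRightAction (K : Type*) [Field K] (n m : ℕ) :
    MulAction (SL(n, K) × SL(n, K)) (MatTuple K n m) where
  smul g X := fun i =>
    (g.1 : Matrix (Fin n) (Fin n) K) * X i * ((g.2⁻¹ : SL(n, K)) : Matrix (Fin n) (Fin n) K)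
  one_smul X := by
    funext i
    change ((1 : SL(n, K)) : Matrix (Fin n) (Fin n) K) * X i *
      ((1⁻¹ : SL(n, K)) : Matrix (Fin n) (Fin n) K) = X i
    rw [inv_one, Matrix.SpecialLinearGroup.coe_one, one_mul, mul_one]
  mul_smul g h X := by
    funext i
    change ((g.1 * h.1 : SL(n, K)) : Matrix (Fin n) (Fin n) K) * X i *
        (((g.2 * h.2)⁻¹ : SL(n, K)) : Matrix (Fin n) (Fin n) K) =
      (g.1 : Matrix (Fin n) (Fin n) K) *
        ((h.1 : Matrix (Fin n) (Fin n) K) * X i *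
          ((h.2⁻¹ : SL(n, K)) : Matrix (Fin n) (Fin n) K)) *
        ((g.2⁻¹ : SL(n, K)) : Matrix (Fin n) (Fin n) K)
    rw [mul_inv_rev, Matrix.SpecialLinearGroup.coe_mul, Matrix.SpecialLinearGroup.coe_mul]
    simp only [mul_assoc]

/-- `X ∼_C Y`: closure equivalence for simultaneous conjugation by `GLₙ`. -/
def ConjEquiv {K : Type*} [Field K] {n m : ℕ} (X Y : MatTuple K n m) : Prop :=
  ClosureEquiv (conjAction K n m) X Y

/-- `X ∼_LR Y`: closure equivalence for the left-right action of `SLₙ × SLₙ`. -/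
def LeftRightEquiv {K : Type*} [Field K] {n m : ℕ} (X Y : MatTuple K n m) : Prop :=
  ClosureEquiv (leftRightAction K n m) X Y

/-! Polynomial maps are Zariski continuous, so one that sends orbits into orbits sends a common
point of two orbit closures to a common point of the image closures. Such maps exist in both
directions. From left-right to conjugation: the determinant of the leading matrix is constant on a
left-right orbit, so dividing by that matrix is polynomial, via the adjugate
(`mapsTo_adjugateQuotient_orbit`). Back: prepend a fixed `D` of the same determinant and multiply by
it (`mapsTo_leftMulCons_orbit`). Algebraic closedness lets conjugation by `GL` be done inside `SL`.
-/

/-- A map of matrix tuples each of whose matrix entries is a polynomial in the matrix entries. -/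
def IsPolynomialMap {K : Type*} [Field K] {n m k : ℕ}
    (f : MatTuple K n m → MatTuple K n k) : Prop :=
  ∃ F : Fin k × Fin n × Fin n → MvPolynomial (Fin m × Fin n × Fin n) K,
    ∀ X p, (f X).coords p = MvPolynomial.aeval X.coords (F p)

theorem mem_zariskiClosure_iff {K : Type*} [Field K] {n m : ℕ} {S : Set (MatTuple K n m)}
    {X : MatTuple K n m} :
    X ∈ zariskiClosure S ↔ ∀ p : MvPolynomial (Fin m × Fin n × Fin n) K,
      (∀ Y ∈ S, MvPolynomial.aeval Y.coords p = 0) → MvPolynomial.aeval X.coords p = 0 := by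
  simp [zariskiClosure, MvPolynomial.mem_zeroLocus_iff, MvPolynomial.mem_vanishingIdeal_iff]

/-- A polynomial map is continuous for the Zariski topology. -/
theorem IsPolynomialMap.mapsTo_zariskiClosure {K : Type*} [Field K] {n m k : ℕ}
    {f : MatTuple K n m → MatTuple K n k} (hf : IsPolynomialMap f)
    {S : Set (MatTuple K n m)} {T : Set (MatTuple K n k)} (h : Set.MapsTo f S T) :
    Set.MapsTo f (zariskiClosure S) (zariskiClosure T) := by
  obtain ⟨F, hF⟩ := hf
  have key (p : MvPolynomial (Fin k × Fin n × Fin n) K) (X : MatTuple K n m) :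
      MvPolynomial.aeval X.coords (MvPolynomial.bind₁ F p) =
        MvPolynomial.aeval (f X).coords p := by
    rw [MvPolynomial.aeval_bind₁]
    congr 2
    exact (funext (hF X)).symm
  intro X hX
  rw [mem_zariskiClosure_iff] at hX ⊢
  intro p hp
  rw [← key]
  refine hX _ fun Y hY => ?_
  rw [key]
  exact hp _ (h hY)

/-- The tuple of generic matrices. -/
noncomputable def genericMatrix (K : Type*) [Field K] (n m : ℕ) (i : Fin m) :
    Matrix (Fin n) (Fin n) (MvPolynomial (Fin m × Fin n × Fin n) K) :=
  Matrix.of fun a b => MvPolynomial.X (i, a, b)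

theorem genericMatrix_map_aeval {K : Type*} [Field K] {n m : ℕ} (X : MatTuple K n m)
    (i : Fin m) :
    (genericMatrix K n m i).map (MvPolynomial.aeval X.coords) = X i := by
  ext a b
  simp [genericMatrix, MatTuple.coords]

theorem isPolynomialMap_of_matrix {K : Type*} [Field K] {n m k : ℕ}
    {f : MatTuple K n m → MatTuple K n k}
    (F : Fin k → Matrix (Fin n) (Fin n) (MvPolynomial (Fin m × Fin n × Fin n) K))
    (hF : ∀ X i, f X i = (F i).map (MvPolynomial.aeval X.coords)) :
    IsPolynomialMap f :=
  ⟨fun p => F p.1 p.2.1 p.2.2, fun X p => by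
    rw [MatTuple.coords, hF]
    rfl⟩

/-- Prepending a constant matrix `D` and multiplying by `D` on the left. -/
def leftMulCons {K : Type*} [Field K] {n m : ℕ} (D : Matrix (Fin n) (Fin n) K)
    (Z : MatTuple K n m) : MatTuple K n (m + 1) :=
  Fin.cons D fun i => D * Z i

theorem isPolynomialMap_leftMulCons {K : Type*} [Field K] {n m : ℕ}
    (D : Matrix (Fin n) (Fin n) K) :
    IsPolynomialMap (leftMulCons D : MatTuple K n m → MatTuple K n (m + 1)) := by
  have hD (X : MatTuple K n m) :
      (D.map MvPolynomial.C).map (MvPolynomial.aeval X.coords) = D := by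
    ext a b
    simp
  refine isPolynomialMap_of_matrix (Fin.cons (D.map MvPolynomial.C)
    fun i => D.map MvPolynomial.C * genericMatrix K n m i) fun X i => ?_
  refine Fin.cases ?_ (fun i => ?_) i
  · simp only [leftMulCons, Fin.cons_zero, hD]
  · simp only [leftMulCons, Fin.cons_succ, Matrix.map_mul, hD, genericMatrix_map_aeval]

/-- The polynomial map which agrees with `X ↦ (X₀⁻¹ X₁, …, X₀⁻¹ Xₘ)` where `det X₀ = d`. -/
noncomputable def adjugateQuotient {K : Type*} [Field K] {n m : ℕ} (d : K)
    (X : MatTuple K n (m + 1)) : MatTuple K n m :=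
  fun i => d⁻¹ • ((X 0).adjugate * X i.succ)

theorem isPolynomialMap_adjugateQuotient {K : Type*} [Field K] {n m : ℕ} (d : K) :
    IsPolynomialMap (adjugateQuotient d : MatTuple K n (m + 1) → MatTuple K n m) := by
  refine isPolynomialMap_of_matrix (fun i => d⁻¹ •
    ((genericMatrix K n (m + 1) 0).adjugate * genericMatrix K n (m + 1) i.succ)) fun X i => ?_
  have h := AlgHom.map_adjugate (MvPolynomial.aeval (R := K) X.coords)
    (genericMatrix K n (m + 1) 0)
  simp only [AlgHom.mapMatrix_apply, genericMatrix_map_aeval] at h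
  rw [Matrix.map_smul _ _ (fun a => map_smul _ _ a), Matrix.map_mul, h,
    genericMatrix_map_aeval, adjugateQuotient]

/-- Over an algebraically closed field every invertible matrix is a scalar multiple of a matrix of
determinant one. -/
theorem exists_specialLinearGroup_smul_eq {K : Type*} [Field K] [IsAlgClosed K] {n : ℕ}
    (g : GL (Fin n) K) :
    ∃ (c : K) (s : SL(n, K)), c ≠ 0 ∧
      (g : Matrix (Fin n) (Fin n) K) = c • (s : Matrix (Fin n) (Fin n) K) := by
  have hg : (g : Matrix (Fin n) (Fin n) K).det ≠ 0 :=
    ((Matrix.isUnit_iff_isUnit_det _).1 g.isUnit).ne_zero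
  rcases Nat.eq_zero_or_pos n with rfl | hn
  · exact ⟨1, 1, one_ne_zero, Subsingleton.elim _ _⟩
  · obtain ⟨c, hc⟩ := IsAlgClosed.exists_pow_nat_eq (g : Matrix (Fin n) (Fin n) K).det hn
    have hc0 : c ≠ 0 := by
      rintro rfl
      exact hg (by rw [← hc, zero_pow hn.ne'])
    refine ⟨c, ⟨c⁻¹ • (g : Matrix (Fin n) (Fin n) K), ?_⟩, hc0, ?_⟩
    · rw [Matrix.det_smul, Fintype.card_fin, ← hc, ← mul_pow, inv_mul_cancel₀ hc0, one_pow]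
    · exact (smul_inv_smul₀ hc0 _).symm

/-- Conjugation by an invertible matrix is conjugation by a matrix of determinant one. -/
theorem exists_specialLinearGroup_conj_eq {K : Type*} [Field K] [IsAlgClosed K] {n : ℕ}
    (g : GL (Fin n) K) :
    ∃ s : SL(n, K), ∀ X : Matrix (Fin n) (Fin n) K,
      (g : Matrix (Fin n) (Fin n) K) * X * ((g⁻¹ : GL (Fin n) K) : Matrix (Fin n) (Fin n) K) =
        (s : Matrix (Fin n) (Fin n) K) * X * ((s⁻¹ : SL(n, K)) : Matrix (Fin n) (Fin n) K) := by
  obtain ⟨c, s, hc, hs⟩ := exists_specialLinearGroup_smul_eq g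
  refine ⟨s, fun X => ?_⟩
  have hinv : ((g⁻¹ : GL (Fin n) K) : Matrix (Fin n) (Fin n) K) =
      c⁻¹ • ((s⁻¹ : SL(n, K)) : Matrix (Fin n) (Fin n) K) := by
    refine Units.inv_eq_of_mul_eq_one_right ?_
    rw [hs, smul_mul_smul_comm, mul_inv_cancel₀ hc, one_smul,
      ← Matrix.SpecialLinearGroup.coe_mul, mul_inv_cancel, Matrix.SpecialLinearGroup.coe_one]
  rw [hinv, hs, smul_mul_assoc, smul_mul_smul_comm, mul_inv_cancel₀ hc, one_smul]

/-- The factor `P` cancels: `(P A₀ Q⁻¹)⁻¹ (P Aᵢ Q⁻¹) = Q (A₀⁻¹ Aᵢ) Q⁻¹`. In adjugate form this holds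
because the adjugate reverses products and is the inverse on `SL`. -/
theorem mapsTo_adjugateQuotient_orbit {K : Type*} [Field K] {n m : ℕ}
    (A : MatTuple K n (m + 1)) :
    Set.MapsTo (adjugateQuotient (A 0).det)
      (@MulAction.orbit _ _ (leftRightAction K n (m + 1)).toSMul A)
      (@MulAction.orbit _ _ (conjAction K n m).toSMul
        (fun i : Fin m => (A 0)⁻¹ * A i.succ)) := by
  rintro _ ⟨⟨P, Q⟩, rfl⟩
  refine ⟨(Q : GL (Fin n) K), funext fun i => ?_⟩
  change (Q : Matrix (Fin n) (Fin n) K) * ((A 0)⁻¹ * A i.succ) *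
      ((Q⁻¹ : SL(n, K)) : Matrix (Fin n) (Fin n) K) =
    (A 0).det⁻¹ •
      (((P : Matrix (Fin n) (Fin n) K) * A 0 *
        ((Q⁻¹ : SL(n, K)) : Matrix (Fin n) (Fin n) K)).adjugate *
      ((P : Matrix (Fin n) (Fin n) K) * A i.succ *
        ((Q⁻¹ : SL(n, K)) : Matrix (Fin n) (Fin n) K)))
  have hP : (P : Matrix (Fin n) (Fin n) K).adjugate * (P : Matrix (Fin n) (Fin n) K) = 1 := by
    rw [Matrix.adjugate_mul, P.2, one_smul]
  have hQ : (((Q⁻¹ : SL(n, K)) : Matrix (Fin n) (Fin n) K)).adjugate = Q := by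
    rw [← Matrix.SpecialLinearGroup.coe_inv, inv_inv]
  rw [Matrix.adjugate_mul_distrib, Matrix.adjugate_mul_distrib, hQ, Matrix.inv_def,
    Ring.inverse_eq_inv]
  simp only [smul_mul_assoc, mul_smul_comm, mul_assoc]
  rw [← mul_assoc _ (P : Matrix (Fin n) (Fin n) K), hP, one_mul]

/-- `D` is left free, not fixed as `A 0`, so that one and the same map serves both `A` and `B`. -/
theorem mapsTo_leftMulCons_orbit {K : Type*} [Field K] [IsAlgClosed K] {n m : ℕ}
    (A : MatTuple K n (m + 1)) (D : Matrix (Fin n) (Fin n) K) (hdet : D.det = (A 0).det)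
    (hne : (A 0).det ≠ 0) :
    Set.MapsTo (leftMulCons D)
      (@MulAction.orbit _ _ (conjAction K n m).toSMul
        (fun i : Fin m => (A 0)⁻¹ * A i.succ))
      (@MulAction.orbit _ _ (leftRightAction K n (m + 1)).toSMul A) := by
  rintro _ ⟨g, rfl⟩
  obtain ⟨s, hs⟩ := exists_specialLinearGroup_conj_eq g
  -- The left factor is forced by `P A₀ s⁻¹ = D`; equality of determinants puts it in `SL`.
  have hP : (D * (s : Matrix (Fin n) (Fin n) K) * (A 0)⁻¹).det = 1 := by
    rw [Matrix.det_mul, Matrix.det_mul, s.2, Matrix.det_nonsing_inv, Ring.inverse_eq_inv, hdet,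
      mul_one, mul_inv_cancel₀ hne]
  refine ⟨(⟨D * (s : Matrix (Fin n) (Fin n) K) * (A 0)⁻¹, hP⟩, s), funext fun i => ?_⟩
  refine Fin.cases ?_ (fun i => ?_) i
  · change D * (s : Matrix (Fin n) (Fin n) K) * (A 0)⁻¹ * A 0 *
      ((s⁻¹ : SL(n, K)) : Matrix (Fin n) (Fin n) K) = D
    rw [mul_assoc _ (A 0)⁻¹, Matrix.nonsing_inv_mul _ (isUnit_iff_ne_zero.2 hne), mul_one,
      mul_assoc, ← Matrix.SpecialLinearGroup.coe_mul, mul_inv_cancel,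
      Matrix.SpecialLinearGroup.coe_one, mul_one]
  · change D * (s : Matrix (Fin n) (Fin n) K) * (A 0)⁻¹ * A i.succ *
      ((s⁻¹ : SL(n, K)) : Matrix (Fin n) (Fin n) K) =
      D * ((g : Matrix (Fin n) (Fin n) K) * ((A 0)⁻¹ * A i.succ) *
        ((g⁻¹ : GL (Fin n) K) : Matrix (Fin n) (Fin n) K))
    rw [hs]
    simp only [mul_assoc]

theorem proposition3p4 {K : Type*} [Field K] [IsAlgClosed K] (n m : ℕ)
    (A B : MatTuple K n (m + 1))
    (hdet : (A 0).det = (B 0).det) (hne : (A 0).det ≠ 0) :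
    LeftRightEquiv A B ↔
      ConjEquiv (fun i : Fin m => (A 0)⁻¹ * A i.succ) (fun i : Fin m => (B 0)⁻¹ * B i.succ) := by
  constructor
  · rintro ⟨W, hA, hB⟩
    have hq := isPolynomialMap_adjugateQuotient (n := n) (m := m) (A 0).det
    exact ⟨adjugateQuotient (A 0).det W,
      hq.mapsTo_zariskiClosure (mapsTo_adjugateQuotient_orbit A) hA,
      hq.mapsTo_zariskiClosure (hdet ▸ mapsTo_adjugateQuotient_orbit B) hB⟩
  · rintro ⟨Z, hA, hB⟩
    have hc := isPolynomialMap_leftMulCons (m := m) (A 0)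
    exact ⟨leftMulCons (A 0) Z,
      hc.mapsTo_zariskiClosure (mapsTo_leftMulCons_orbit A (A 0) rfl hne) hA,
      hc.mapsTo_zariskiClosure (mapsTo_leftMulCons_orbit B (A 0) hdet (hdet ▸ hne)) hB⟩
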